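/- **Theorem 4.3 (Maximal character of the $S$ topology).** Let $T>0$. For $a<b$ let $\mathbb D([a,b])$ be the real vector space of functions $x:[a,b]\to\mathbb R$ that are right-continuous at every $t\in[a,b)$ and have a finite left limit at every $t\in(a,b]$; write $\mathbb D=\mathbb D([0,T])$ and $\|x\|_\infty=\sup_{t\in[0,T]}|x(t)|$. *The $S$ topology.* Let $\mathbb V\subset\mathbb D$ be the set of elements of finite total variation. For $v\in\mathbb V$ let $dv$ be the signed Borel measure on $[0,T]$ with $dv([0,t])=v(t)$ for all $t\in[0,T]$ (so $dv$ has the atom $v(0)$ at $0$). Write $x_n\to_S x_0$ if for every $\varepsilon>0$ there are $v_{n,\varepsilon}\in\mathbb V$, $n=0,1,2,\dots$, with $\|x_n-v_{n,\varepsilon}\|_\infty\le\varepsilon$ for all $n\ge 0$ and $\int_{[0,T]}f\,dv_{n,\varepsilon}\to\int_{[0,T]}f\,dv_{0,\varepsilon}$ as $n\to\infty$ for every continuous $f:[0,T]\to\mathbb R$. The $S$ topology on $\mathbb D$ is the topology whose closed sets are the sets $F\subset\mathbb D$ such that $x_n\in F$ $(n\ge1)$ and $x_n\to_S x_0$ imply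 $x_0\in F$. *The $mJ_1$ topology.* For $a<b$ and $x,y\in\mathbb D([a,b])$ let $d_{Sk}(x,y)$ be the infimum of all $r>0$ for which there is an increasing homeomorphism $\lambda$ of $[a,b]$ onto itself with $$\sup_{s\neq t}\Big|\log\frac{\lambda(t)-\lambda(s)}{t-s}\Big|\le r,\qquad \sup_{t\in[a,b]}|x(t)-y(\lambda(t))|\le r .$$ Fix $\varepsilon>0$ and for $x\in\mathbb D$ define $\widetilde x\in\mathbb D([-\varepsilon,T+\varepsilon])$ by $\widetilde x(t)=0$ for $-\varepsilon\le t<0$, $\widetilde x(t)=x(t)$ for $0\le t<T$, and $\widetilde x(t)=x(T)$ for $T\le t\le T+\varepsilon$. The $mJ_1$ topology on $\mathbb D$ is the topology of the metric $d(x,y)=d_{Sk}(\widetilde x,\widetilde y)$. Then every topology $\sigma$ on $\mathbb D$ for which addition $\mathbb D\times\mathbb D\to\mathbb D$ and scalar multiplication $\mathbb R\times\mathbb D\to\mathbb D$ are continuous, and which is coarser than $mJ_1$ (every $\sigma$-open set is $mJ_1$-open), is also coarser than the $S$ topology (every $\sigma$-open set is $S$-open). -/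

import Mathlib

open Set Filter MeasureTheory
open scoped Topology ENNReal

noncomputable section

namespace SkorokhodS

/-! ### The Skorokhod space -/

/-- `x : [a, b] → ℝ` is right-continuous at every `t ∈ [a, b)` and has a (finite) left limit at
every `t ∈ (a, b]`. -/
def IsCadlag {a b : ℝ} (x : Icc a b → ℝ) : Prop :=
  (∀ t : Icc a b, (t : ℝ) < b → ContinuousWithinAt x (Ioi t) t) ∧
    ∀ t : Icc a b, a < (t : ℝ) → ∃ l : ℝ, Tendsto x (𝓝[<] t) (𝓝 l)

/-- The Skorokhod space `𝔻([a, b])`, as a real vector space. Its topologies are always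
mentioned explicitly below. -/
def Skorokhod (a b : ℝ) : Submodule ℝ (Icc a b → ℝ) where
  carrier := {x | IsCadlag x}
  add_mem' := by
    rintro x y ⟨hx, hx'⟩ ⟨hy, hy'⟩
    refine ⟨fun t ht => (hx t ht).add (hy t ht), fun t ht => ?_⟩
    obtain ⟨l, hl⟩ := hx' t ht
    obtain ⟨m, hm⟩ := hy' t ht
    exact ⟨l + m, hl.add hm⟩
  zero_mem' := ⟨fun _ _ => continuousWithinAt_const, fun _ _ => ⟨0, tendsto_const_nhds⟩⟩
  smul_mem' := by
    rintro c x ⟨hx, hx'⟩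
    refine ⟨fun t ht => (hx t ht).const_smul c, fun t ht => ?_⟩
    obtain ⟨l, hl⟩ := hx' t ht
    exact ⟨c • l, hl.const_smul c⟩

/-! ### Integration with respect to functions of bounded variation -/

instance instCompactIccSpaceIcc (a b : ℝ) : CompactIccSpace (Icc a b) :=
  ⟨fun {_ _} => isClosed_Icc.isCompact⟩

/-- The signed measure `dv` on `[a, b]` of a right-continuous function `v` of bounded variation,
that is, the one with `dv([a, t]) = v(t)`. It consists of the Stieltjes measure of `v`
(of mass `v t - v s` on `(s, t]`, without mass at `a`) and of an atom of mass `v(a)` at `a`. -/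
def stieltjes {a b : ℝ} (hab : a ≤ b) {v : Icc a b → ℝ} (hv : BoundedVariationOn v univ) :
    SignedMeasure (Icc a b) :=
  hv.vectorMeasure + VectorMeasure.dirac ⟨a, left_mem_Icc.2 hab⟩ (v ⟨a, left_mem_Icc.2 hab⟩)

/-! ### The `S` topology -/

/-- `S`-convergence `xₙ → x₀` in `𝔻([a, b])`: for every `ε > 0` there are elements
`vₙ` (`n ∈ ℕ`) and `v₀` of `𝔻([a, b])` with finite total variation,
`‖xₙ - vₙ‖_∞ ≤ ε` and `‖x₀ - v₀‖_∞ ≤ ε`, such that `∫ f dvₙ → ∫ f dv₀` for every continuous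
function `f` on `[a, b]`. -/
def SConv {a b : ℝ} (hab : a ≤ b) (x : ℕ → Skorokhod a b) (x₀ : Skorokhod a b) : Prop :=
  ∀ ε : ℝ, 0 < ε →
    ∃ (v : ℕ → Skorokhod a b) (v₀ : Skorokhod a b)
      (hv : ∀ n, BoundedVariationOn (v n : Icc a b → ℝ) univ)
      (hv₀ : BoundedVariationOn (v₀ : Icc a b → ℝ) univ),
      (∀ n t, |(x n : Icc a b → ℝ) t - (v n : Icc a b → ℝ) t| ≤ ε) ∧
      (∀ t, |(x₀ : Icc a b → ℝ) t - (v₀ : Icc a b → ℝ) t| ≤ ε) ∧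
      ∀ f : C(Icc a b, ℝ),
        Tendsto (fun n => ∫ᵛ t, f t ∂•(stieltjes hab (hv n))) atTop
          (𝓝 (∫ᵛ t, f t ∂•(stieltjes hab hv₀)))

lemma SConv.subseq {a b : ℝ} {hab : a ≤ b} {x : ℕ → Skorokhod a b} {x₀ : Skorokhod a b}
    (h : SConv hab x x₀) {φ : ℕ → ℕ} (hφ : StrictMono φ) : SConv hab (x ∘ φ) x₀ := by
  intro ε hε
  obtain ⟨v, v₀, hv, hv₀, h1, h2, h3⟩ := h ε hε
  exact ⟨v ∘ φ, v₀, fun n => hv (φ n), hv₀, fun n => h1 (φ n), h2,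
    fun f => (h3 f).comp hφ.tendsto_atTop⟩

/-- The `S` topology: the sequential topology generated by `S`-convergence. A set `F` is closed
if and only if limits of `S`-convergent sequences of elements of `F` remain in `F`. -/
@[reducible] def STopology {a b : ℝ} (hab : a ≤ b) : TopologicalSpace (Skorokhod a b) :=
  TopologicalSpace.ofClosed
    {F | ∀ (x : ℕ → Skorokhod a b) (x₀ : Skorokhod a b),
      (∀ n, x n ∈ F) → SConv hab x x₀ → x₀ ∈ F}
    (fun _ _ h _ => h 0)
    (fun _ hA x x₀ hx h F hF => hA hF x x₀ (fun n => hx n F hF) h)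
    (by
      intro A hA B hB x x₀ hx h
      by_cases hfr : ∃ᶠ n in atTop, x n ∈ A
      · obtain ⟨φ, hφ, hφA⟩ := extraction_of_frequently_atTop hfr
        exact Or.inl (hA _ x₀ hφA (h.subseq hφ))
      · have hev : ∃ᶠ n in atTop, x n ∈ B :=
          ((not_frequently.1 hfr).mono fun n hn => (hx n).resolve_left hn).frequently
        obtain ⟨φ, hφ, hφB⟩ := extraction_of_frequently_atTop hev
        exact Or.inr (hB _ x₀ hφB (h.subseq hφ)))

/-! ### The Skorokhod metric -/

/-- `‖λ‖ = sup_{s < t} |log ((λ t - λ s) / (t - s))|` for an increasing bijection `λ` of `[a, b]`,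
as an element of `[0, ∞]`. -/
def logSlope {a b : ℝ} (e : Icc a b ≃o Icc a b) : ℝ≥0∞ :=
  ⨆ (s : Icc a b) (t : Icc a b) (_ : s < t),
    ENNReal.ofReal |Real.log (((e t : ℝ) - e s) / ((t : ℝ) - s))|

/-- Billingsley's complete Skorokhod metric: `d_Sk(x, y)` is the infimum of the `r` for which there
is a time change `λ` (an increasing homeomorphism of `[a, b]` onto itself, equivalently an
order isomorphism) with `‖λ‖ ≤ r` and `sup_t |x(t) - y(λ t)| ≤ r`. -/
def skorokhodEDist {a b : ℝ} (x y : Icc a b → ℝ) : ℝ≥0∞ :=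
  ⨅ e : Icc a b ≃o Icc a b, max (logSlope e) (⨆ t, edist (x t) (y (e t)))

lemma logSlope_refl {a b : ℝ} : logSlope (OrderIso.refl (Icc a b)) = 0 := by
  simp only [logSlope, ENNReal.iSup_eq_zero]
  intro s t hst
  have h : (t : ℝ) - s ≠ 0 := (sub_pos.2 (Subtype.coe_lt_coe.2 hst)).ne'
  simp [div_self h]

lemma logSlope_symm_le {a b : ℝ} (e : Icc a b ≃o Icc a b) : logSlope e.symm ≤ logSlope e := by
  refine iSup_le fun s => iSup_le fun t => iSup_le fun hst => ?_
  have h := le_iSup₂_of_le (f := fun (s : Icc a b) (t : Icc a b) => ⨆ (_ : s < t),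
    ENNReal.ofReal |Real.log (((e t : ℝ) - e s) / ((t : ℝ) - s))|) (e.symm s) (e.symm t)
    (le_iSup_of_le (e.symm.strictMono hst) le_rfl)
  refine le_trans (le_of_eq ?_) h
  rw [e.apply_symm_apply, e.apply_symm_apply, ← inv_div, Real.log_inv, abs_neg]

lemma logSlope_trans_le {a b : ℝ} (e f : Icc a b ≃o Icc a b) :
    logSlope (e.trans f) ≤ logSlope e + logSlope f := by
  refine iSup_le fun s => iSup_le fun t => iSup_le fun hst => ?_
  have h1 := le_iSup₂_of_le (f := fun (s : Icc a b) (t : Icc a b) => ⨆ (_ : s < t),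
    ENNReal.ofReal |Real.log (((e t : ℝ) - e s) / ((t : ℝ) - s))|) s t
    (le_iSup_of_le hst le_rfl)
  have h2 := le_iSup₂_of_le (f := fun (s : Icc a b) (t : Icc a b) => ⨆ (_ : s < t),
    ENNReal.ofReal |Real.log (((f t : ℝ) - f s) / ((t : ℝ) - s))|) (e s) (e t)
    (le_iSup_of_le (e.strictMono hst) le_rfl)
  refine le_trans ?_ (add_le_add h1 h2)
  rw [← ENNReal.ofReal_add (abs_nonneg _) (abs_nonneg _)]
  refine ENNReal.ofReal_le_ofReal ?_
  have p0 : 0 < (t : ℝ) - s := sub_pos.2 (Subtype.coe_lt_coe.2 hst)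
  have p1 : 0 < (e t : ℝ) - e s := sub_pos.2 (Subtype.coe_lt_coe.2 (e.strictMono hst))
  have p2 : 0 < (f (e t) : ℝ) - f (e s) :=
    sub_pos.2 (Subtype.coe_lt_coe.2 (f.strictMono (e.strictMono hst)))
  have hmul : ((f (e t) : ℝ) - f (e s)) / ((t : ℝ) - s) =
      (((e t : ℝ) - e s) / ((t : ℝ) - s)) * (((f (e t) : ℝ) - f (e s)) / ((e t : ℝ) - e s)) := by
    field_simp
  simp only [OrderIso.trans_apply]
  rw [hmul, Real.log_mul (div_pos p1 p0).ne' (div_pos p2 p1).ne']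
  exact abs_add_le _ _

lemma skorokhodEDist_comm_le {a b : ℝ} (x y : Icc a b → ℝ) :
    skorokhodEDist x y ≤ skorokhodEDist y x := by
  refine le_iInf fun e => iInf_le_of_le e.symm (max_le_max (logSlope_symm_le e) ?_)
  refine iSup_le fun t => le_iSup_of_le (e.symm t) ?_
  rw [e.apply_symm_apply, edist_comm]

lemma skorokhodEDist_triangle {a b : ℝ} (x y z : Icc a b → ℝ) :
    skorokhodEDist x z ≤ skorokhodEDist x y + skorokhodEDist y z := by
  rw [skorokhodEDist, skorokhodEDist, skorokhodEDist, ENNReal.iInf_add]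
  refine le_iInf fun e => ?_
  rw [ENNReal.add_iInf]
  refine le_iInf fun f => iInf_le_of_le (e.trans f) (max_le ?_ (iSup_le fun t => ?_))
  · exact (logSlope_trans_le e f).trans (add_le_add (le_max_left _ _) (le_max_left _ _))
  · refine (edist_triangle _ (y (e t)) _).trans (add_le_add ?_ ?_)
    · exact le_max_of_le_right (le_iSup (fun t => edist (x t) (y (e t))) t)
    · exact le_max_of_le_right (le_iSup (fun t => edist (y t) (z (f t))) (e t))

/-- The metric structure of `d_Sk` on `𝔻([a, b])`. -/
@[reducible] def skorokhodMetric (a b : ℝ) : PseudoEMetricSpace (Skorokhod a b) where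
  edist x y := skorokhodEDist (x : Icc a b → ℝ) y
  edist_self x := by
    refine le_antisymm (iInf_le_of_le (OrderIso.refl _) ?_) bot_le
    simp [logSlope_refl]
  edist_comm x y := le_antisymm (skorokhodEDist_comm_le _ _) (skorokhodEDist_comm_le _ _)
  edist_triangle x y z := skorokhodEDist_triangle _ _ _

/-! ### The `mJ₁` topology -/

/-- The extension of `x : [0, T] → ℝ` to `[-ε, T + ε]` by `0` on `[-ε, 0)` and by `x(T)`
on `[T, T + ε]`. -/
def extendFun {T : ℝ} (hT : 0 ≤ T) (ε : ℝ) (x : Icc 0 T → ℝ) (t : Icc (-ε) (T + ε)) : ℝ :=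
  if (t : ℝ) < 0 then 0 else x (projIcc 0 T hT t)

lemma isCadlag_extendFun {T : ℝ} (hT : 0 ≤ T) (ε : ℝ) {x : Icc 0 T → ℝ} (hx : IsCadlag x) :
    IsCadlag (extendFun hT ε x) := by
  have hp : Continuous (fun t : Icc (-ε) (T + ε) => projIcc 0 T hT (t : ℝ)) :=
    continuous_projIcc.comp continuous_subtype_val
  have hc : Continuous (fun t : Icc (-ε) (T + ε) => (t : ℝ)) := continuous_subtype_val
  refine ⟨fun t _ => ?_, fun t _ => ?_⟩
  · rcases lt_or_ge (t : ℝ) 0 with h0 | h0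
    · have hev : extendFun hT ε x =ᶠ[𝓝 t] fun _ => 0 :=
        (hc.continuousAt.eventually_lt continuousAt_const h0).mono fun s hs => if_pos hs
      exact (continuousAt_const.congr hev.symm).continuousWithinAt
    · have hx0 : extendFun hT ε x t = x (projIcc 0 T hT (t : ℝ)) := if_neg (not_lt.2 h0)
      have hev : (fun s : Icc (-ε) (T + ε) => x (projIcc 0 T hT (s : ℝ))) =ᶠ[𝓝[>] t]
          extendFun hT ε x :=
        eventually_nhdsWithin_of_forall fun s hs =>
          (if_neg (not_lt.2 (h0.trans (Subtype.coe_le_coe.2 (le_of_lt hs))))).symm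
      refine Tendsto.congr' hev ?_
      rw [hx0]
      rcases lt_or_ge (t : ℝ) T with h1 | h1
      · have hpt : ((projIcc 0 T hT (t : ℝ) : Icc 0 T) : ℝ) = t := by
          rw [projIcc_of_mem hT ⟨h0, h1.le⟩]
        refine (hx.1 (projIcc 0 T hT (t : ℝ)) (by rw [hpt]; exact h1)).tendsto.comp
          (tendsto_nhdsWithin_iff.2 ⟨(hp.tendsto t).mono_left nhdsWithin_le_nhds, ?_⟩)
        refine eventually_nhdsWithin_of_forall fun s hs => ?_
        have hs' : (t : ℝ) < s := Subtype.coe_lt_coe.2 hs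
        rw [mem_Ioi, ← Subtype.coe_lt_coe, hpt, coe_projIcc]
        exact lt_max_of_lt_right (lt_min h1 hs')
      · refine tendsto_const_nhds.congr' (eventually_nhdsWithin_of_forall fun s hs => ?_)
        have hs' : (t : ℝ) < s := Subtype.coe_lt_coe.2 hs
        simp only [projIcc_of_right_le hT h1, projIcc_of_right_le hT (h1.trans hs'.le)]
  · rcases le_or_gt (t : ℝ) 0 with h0 | h0
    · refine ⟨0, tendsto_const_nhds.congr' (eventually_nhdsWithin_of_forall fun s hs => ?_)⟩
      exact (if_pos ((Subtype.coe_lt_coe.2 hs).trans_le h0)).symm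
    · have hpos : ∀ᶠ s : Icc (-ε) (T + ε) in 𝓝[<] t, (0 : ℝ) < s :=
        nhdsWithin_le_nhds (continuousAt_const.eventually_lt hc.continuousAt h0)
      rcases le_or_gt (t : ℝ) T with h1 | h1
      · have hpt : ((projIcc 0 T hT (t : ℝ) : Icc 0 T) : ℝ) = t := by
          rw [projIcc_of_mem hT ⟨h0.le, h1⟩]
        obtain ⟨l, hl⟩ := hx.2 (projIcc 0 T hT (t : ℝ)) (by rw [hpt]; exact h0)
        refine ⟨l, (hl.comp (tendsto_nhdsWithin_iff.2
          ⟨(hp.tendsto t).mono_left nhdsWithin_le_nhds, ?_⟩)).congr' ?_⟩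
        · refine eventually_nhdsWithin_of_forall fun s hs => ?_
          have hs' : (s : ℝ) < t := Subtype.coe_lt_coe.2 hs
          rw [mem_Iio, ← Subtype.coe_lt_coe, hpt, coe_projIcc]
          exact max_lt h0 (min_lt_of_right_lt hs')
        · exact hpos.mono fun s hs => (if_neg (not_lt.2 hs.le)).symm
      · refine ⟨x (projIcc 0 T hT T), tendsto_const_nhds.congr' ?_⟩
        have hgt : ∀ᶠ s : Icc (-ε) (T + ε) in 𝓝[<] t, T < (s : ℝ) :=
          nhdsWithin_le_nhds (continuousAt_const.eventually_lt hc.continuousAt h1)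
        filter_upwards [hgt] with s hs
        rw [extendFun, if_neg (not_lt.2 (hT.trans hs.le)), projIcc_of_right_le hT hs.le,
          projIcc_of_right_le hT le_rfl]

/-- The embedding `x ↦ x̃` of `𝔻([0, T])` into `𝔻([-ε, T + ε])`. -/
def extend {T : ℝ} (hT : 0 ≤ T) (ε : ℝ) (x : Skorokhod 0 T) : Skorokhod (-ε) (T + ε) :=
  ⟨extendFun hT ε x, isCadlag_extendFun hT ε x.2⟩

/-- The `mJ₁` topology on `𝔻([0, T])`: the topology of the metric
`d(x, y) = d_Sk(x̃, ỹ)`, where `d_Sk` is the Skorokhod metric of `𝔻([-ε, T + ε])`. -/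
@[reducible] def mJ1Topology {T : ℝ} (hT : 0 ≤ T) (ε : ℝ) : TopologicalSpace (Skorokhod 0 T) :=
  (PseudoEMetricSpace.induced (extend hT ε)
    (skorokhodMetric (-ε) (T + ε))).toUniformSpace.toTopologicalSpace

end SkorokhodS

end

noncomputable section

namespace SkorokhodS

/-! ### Jump functions -/

/-! It suffices that an `S`-convergent sequence `xₙ → x₀` meets every `σ`-neighbourhood of `x₀`
(`SConv.exists_mem_of_mem_nhds`); the complement of a `σ`-open set is then `S`-closed.

Replace `xₙ` by `vₙ` of bounded variation, uniformly within `h`. Weak convergence of `dvₙ` and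
Banach–Steinhaus bound the total variations (`exists_totalVariation_le`). Hence each `vₙ` is
uniformly within `2h` of a step function `wₙ` with a number of jumps independent of `n`
(`exists_steps_signedMeasure`). Its coefficients lie in `[-h, h]` and its jump points in `[0, T]`,
so the parameters range over a compact space and converge along a subsequence.

A single jump `𝟙_[q, T]` depends `mJ₁`-continuously on `q` (`continuous_jump`). Since `σ` is linear
and coarser than `mJ₁`, finite sums of jumps depend `σ`-continuously on their parameters
(`continuous_steps`), so `wₙ → w₀` in `σ` along the subsequence. The bound `2h` survives the weak
limit (`abs_sub_steps_le_of_tendsto`), so `w₀` is uniformly close to `x₀`. Thus `xₙ - x₀ = (xₙ - wₙ)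
+ (wₙ - w₀) + (w₀ - x₀)` has two uniformly small terms and one `σ`-small term, and uniformly small
functions are `σ`-small (`exists_uniform_ball_subset`). -/

/-- The indicator function of `[q, b]`, as an element of `𝔻([a, b])`. -/
def jump {a b : ℝ} (q : Icc a b) : Skorokhod a b :=
  ⟨fun t => if q ≤ t then 1 else 0, by
    refine ⟨fun t _ => ?_, fun t _ => ?_⟩
    · by_cases h : q ≤ t
      · refine (continuousWithinAt_const (b := (1 : ℝ))).congr_of_eventuallyEq
          (eventually_nhdsWithin_of_forall fun s hs => if_pos (h.trans (le_of_lt hs))) (if_pos h)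
      · have hev : (fun t => if q ≤ t then (1 : ℝ) else 0) =ᶠ[𝓝 t] fun _ => 0 :=
          (eventually_lt_nhds (not_le.1 h)).mono fun s hs => if_neg (not_le.2 hs)
        exact (continuousAt_const.congr hev.symm).continuousWithinAt
    · by_cases h : q < t
      · refine ⟨1, tendsto_const_nhds.congr' (nhdsWithin_le_nhds ?_)⟩
        exact (eventually_gt_nhds h).mono fun s hs => (if_pos (le_of_lt hs)).symm
      · refine ⟨0, tendsto_const_nhds.congr' (eventually_nhdsWithin_of_forall fun s hs => ?_)⟩
        exact (if_neg (not_le.2 (lt_of_lt_of_le hs (not_lt.1 h)))).symm⟩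

lemma jump_apply {a b : ℝ} (q t : Icc a b) :
    (jump q : Icc a b → ℝ) t = if q ≤ t then 1 else 0 := rfl

/-! ### Quadratic time changes -/

/-- The function `t ↦ t + c (t - a) (b - t)`, which fixes `a` and `b`. -/
def quadFun (a b c t : ℝ) : ℝ := t + c * (t - a) * (b - t)

/-- The last factor is the chord slope. It differs from 1 by at most `|c| (b - a)`, which controls
both monotonicity and the logarithmic slope. -/
lemma quadFun_sub (a b c s t : ℝ) :
    quadFun a b c t - quadFun a b c s = (t - s) * (1 + c * (a + b - s - t)) := by
  unfold quadFun; ring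

lemma abs_slope_sub_one_le {a b c s t : ℝ} (hs : s ∈ Icc a b) (ht : t ∈ Icc a b) :
    |c * (a + b - s - t)| ≤ |c| * (b - a) := by
  rw [abs_mul]
  refine mul_le_mul_of_nonneg_left (abs_le.2 ⟨?_, ?_⟩) (abs_nonneg _) <;>
    linarith [hs.1, hs.2, ht.1, ht.2]

lemma slope_pos {a b c s t : ℝ} (hc : |c| * (b - a) < 1) (hs : s ∈ Icc a b) (ht : t ∈ Icc a b) :
    0 < 1 + c * (a + b - s - t) := by
  linarith [(abs_le.1 (abs_slope_sub_one_le (c := c) hs ht)).1]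

lemma quadFun_strictMonoOn {a b c : ℝ} (hc : |c| * (b - a) < 1) :
    StrictMonoOn (quadFun a b c) (Icc a b) := by
  intro s hs t ht hst
  have := mul_pos (sub_pos.2 hst) (slope_pos hc hs ht)
  rw [← quadFun_sub] at this
  linarith

lemma quadFun_left (a b c : ℝ) : quadFun a b c a = a := by simp [quadFun]

lemma quadFun_right (a b c : ℝ) : quadFun a b c b = b := by simp [quadFun]

lemma quadFun_surjOn {a b : ℝ} (hab : a ≤ b) (c : ℝ) :
    SurjOn (quadFun a b c) (Icc a b) (Icc a b) := by
  have hcont : ContinuousOn (quadFun a b c) (Icc a b) := by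
    unfold quadFun; fun_prop
  have h := intermediate_value_Icc hab hcont
  rwa [quadFun_left, quadFun_right] at h

lemma quadFun_mapsTo {a b c : ℝ} (hab : a ≤ b) (hc : |c| * (b - a) < 1) :
    MapsTo (quadFun a b c) (Icc a b) (Icc a b) := by
  intro t ht
  have hm := (quadFun_strictMonoOn hc).monotoneOn
  have h1 := hm (left_mem_Icc.2 hab) ht ht.1
  have h2 := hm ht (right_mem_Icc.2 hab) ht.2
  rw [quadFun_left] at h1
  rw [quadFun_right] at h2
  exact ⟨h1, h2⟩

/-- The time change `t ↦ t + c (t - a) (b - t)` of `[a, b]`, for small `c`. -/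
def quadTimeChange {a b c : ℝ} (hab : a ≤ b) (hc : |c| * (b - a) < 1) : Icc a b ≃o Icc a b :=
  StrictMono.orderIsoOfSurjective
    (fun t : Icc a b => (⟨quadFun a b c t, quadFun_mapsTo hab hc t.2⟩ : Icc a b))
    (fun s t hst => quadFun_strictMonoOn hc s.2 t.2 hst)
    (fun y => by
      obtain ⟨t, ht, hty⟩ := quadFun_surjOn hab c y.2
      exact ⟨⟨t, ht⟩, Subtype.ext hty⟩)

lemma coe_quadTimeChange {a b c : ℝ} (hab : a ≤ b) (hc : |c| * (b - a) < 1) (t : Icc a b) :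
    (quadTimeChange hab hc t : ℝ) = quadFun a b c t := rfl

lemma abs_log_one_add_le {x r : ℝ} (hx : |x| ≤ r) (hr : r ≤ 1 / 2) :
    |Real.log (1 + x)| ≤ 2 * r := by
  have h := abs_le.1 hx
  have hpos : 0 < 1 + x := by linarith
  have hr0 : 0 ≤ r := (abs_nonneg _).trans hx
  refine abs_le.2 ⟨?_, ?_⟩
  · have h1 := Real.log_le_sub_one_of_pos (inv_pos.2 hpos)
    rw [Real.log_inv] at h1
    have h2 : (1 + x)⁻¹ ≤ 1 + 2 * r := by
      rw [inv_le_iff_one_le_mul₀ hpos]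
      nlinarith
    linarith
  · linarith [Real.log_le_sub_one_of_pos hpos]

lemma logSlope_quadTimeChange_le {a b c : ℝ} (hab : a ≤ b) (hc : |c| * (b - a) ≤ 1 / 2) :
    logSlope (quadTimeChange hab (hc.trans_lt (by norm_num))) ≤
      ENNReal.ofReal (2 * (|c| * (b - a))) := by
  refine iSup_le fun s => iSup_le fun t => iSup_le fun hst => ENNReal.ofReal_le_ofReal ?_
  rw [coe_quadTimeChange, coe_quadTimeChange, quadFun_sub,
    mul_div_cancel_left₀ _ (sub_pos.2 (Subtype.coe_lt_coe.2 hst)).ne']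
  exact abs_log_one_add_le (abs_slope_sub_one_le s.2 t.2) hc

/-! ### The `mJ₁` topology: uniform convergence and convergence of jumps -/

/-- The padding by 0 on the left makes even `q = 0` a genuine jump. When `ε > 0`, every `q` is
interior to the enlarged interval and can be moved by a time change. -/
lemma extendFun_jump {T : ℝ} (hT : 0 ≤ T) (ε : ℝ) (q : Icc 0 T) (t : Icc (-ε) (T + ε)) :
    extendFun hT ε (jump q) t = if (q : ℝ) ≤ t then 1 else 0 := by
  unfold extendFun
  split_ifs with h1 h2 h2
  · linarith [q.2.1]
  · rfl
  · rw [jump_apply, if_pos]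
    rw [← Subtype.coe_le_coe, coe_projIcc]
    exact le_max_of_le_right (le_min q.2.2 h2)
  · rw [jump_apply, if_neg]
    rw [← Subtype.coe_le_coe, coe_projIcc, not_le]
    push Not at h1 h2
    rw [max_lt_iff]
    exact ⟨h1.trans_lt h2, min_lt_of_right_lt h2⟩

/-- A time change carrying `p` to `q` makes the two indicators coincide exactly, so only its
logarithmic slope costs anything. -/
lemma skorokhodEDist_extendFun_jump_le {T : ℝ} (hT : 0 ≤ T) {ε : ℝ} (hε : 0 < ε) (p q : Icc 0 T)
    {c : ℝ} (hc : |c| * (T + ε - -ε) ≤ 1 / 2) (hpq : quadFun (-ε) (T + ε) c p = q) :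
    skorokhodEDist (extendFun hT ε (jump p)) (extendFun hT ε (jump q)) ≤
      ENNReal.ofReal (2 * (|c| * (T + ε - -ε))) := by
  have hab : -ε ≤ T + ε := by linarith
  have hc' : |c| * (T + ε - -ε) < 1 := hc.trans_lt (by norm_num)
  have hp : (p : ℝ) ∈ Icc (-ε) (T + ε) := ⟨by linarith [p.2.1], by linarith [p.2.2]⟩
  refine iInf_le_of_le (quadTimeChange hab hc') (max_le (logSlope_quadTimeChange_le hab hc) ?_)
  refine iSup_le fun t => ?_
  rw [extendFun_jump, extendFun_jump, coe_quadTimeChange, ← hpq,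
    if_congr ((quadFun_strictMonoOn hc').le_iff_le hp t.2) rfl rfl]
  simp

lemma continuous_of_tendsto_edist {X Y : Type*} [TopologicalSpace Y] [PseudoEMetricSpace X]
    {f : Y → X} (h : ∀ p, Tendsto (fun q => edist (f p) (f q)) (𝓝 p) (𝓝 0)) : Continuous f := by
  rw [continuous_iff_continuousAt]
  intro p
  rw [ContinuousAt, EMetric.tendsto_nhds]
  intro r hr
  filter_upwards [(h p).eventually_lt_const hr] with q hq
  rwa [edist_comm]

/-- The map `q ↦ 𝟙_[q, T]` is continuous from `[0, T]` to `𝔻([0, T])` with the `mJ₁` topology. -/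
lemma continuous_jump {T : ℝ} (hT : 0 ≤ T) {ε : ℝ} (hε : 0 < ε) :
    Continuous[_, mJ1Topology hT ε] (jump : Icc 0 T → Skorokhod 0 T) := by
  refine @continuous_of_tendsto_edist _ _ _
    (PseudoEMetricSpace.induced (extend hT ε) (skorokhodMetric (-ε) (T + ε))) _ fun p => ?_
  have hd : 0 < (p - -ε) * (T + ε - p) :=
    mul_pos (by linarith [p.2.1]) (by linarith [p.2.2])
  -- The solution `c` of `quadFun (-ε) (T + ε) c p = q`; it tends to 0 as `q → p`.
  set c : Icc 0 T → ℝ := fun q => (q - p) / ((p - -ε) * (T + ε - p)) with hcdef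
  have hq : ∀ q : Icc 0 T, quadFun (-ε) (T + ε) (c q) p = q := by
    intro q
    rw [quadFun, mul_assoc, hcdef]
    dsimp only
    rw [div_mul_cancel₀ _ hd.ne']
    ring
  have hccont : Tendsto (fun q => |c q| * (T + ε - -ε)) (𝓝 p) (𝓝 0) := by
    have : Continuous fun q => |c q| * (T + ε - -ε) := by fun_prop
    have h := this.tendsto p
    simpa [hcdef] using h
  have hle : ∀ᶠ q in 𝓝 p, |c q| * (T + ε - -ε) ≤ 1 / 2 :=
    hccont.eventually_le_const (by norm_num)
  have hlim : Tendsto (fun q => ENNReal.ofReal (2 * (|c q| * (T + ε - -ε)))) (𝓝 p) (𝓝 0) := by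
    simpa using ENNReal.tendsto_ofReal (hccont.const_mul 2)
  refine tendsto_of_tendsto_of_tendsto_of_le_of_le' tendsto_const_nhds hlim
    (Eventually.of_forall fun _ => zero_le) ?_
  filter_upwards [hle] with q h1
  exact skorokhodEDist_extendFun_jump_le hT hε p q h1 (hq q)

/-- Every `mJ₁`-neighbourhood of `0` contains a ball of the uniform norm. -/
lemma exists_uniform_ball_subset {T : ℝ} (hT : 0 ≤ T) (ε : ℝ) {V : Set (Skorokhod 0 T)}
    (hV : V ∈ @nhds _ (mJ1Topology hT ε) 0) :
    ∃ η > 0, ∀ x : Skorokhod 0 T, (∀ t, |(x : Icc 0 T → ℝ) t| ≤ η) → x ∈ V := by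
  obtain ⟨r, hr, hball⟩ := (@EMetric.mem_nhds_iff _
    (PseudoEMetricSpace.induced (extend hT ε) (skorokhodMetric (-ε) (T + ε))) _ _).1 hV
  obtain ⟨η, hη, hηr⟩ := ENNReal.lt_iff_exists_real_btwn.1 hr
  have hη0 : 0 < η := by simpa using hηr.1
  refine ⟨η, hη0, fun x hx => hball ?_⟩
  change skorokhodEDist (extendFun hT ε x) (extendFun hT ε (0 : Skorokhod 0 T)) < r
  refine lt_of_le_of_lt (iInf_le_of_le (OrderIso.refl _) (max_le ?_ (iSup_le fun t => ?_))) hηr.2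
  · simp [logSlope_refl]
  · rw [edist_dist, Real.dist_eq]
    refine ENNReal.ofReal_le_ofReal ?_
    have h0 : extendFun hT ε (0 : Skorokhod 0 T) (OrderIso.refl _ t) = 0 := ite_self 0
    rw [h0, sub_zero, extendFun]
    split_ifs
    · simpa using hη0.le
    · exact hx _

/-! ### Integrals with respect to signed measures -/

section SignedMeasure

variable {α : Type*} [MeasurableSpace α]

instance instIsFiniteMeasureTotalVariation (μ : SignedMeasure α) :
    IsFiniteMeasure μ.totalVariation := by
  unfold SignedMeasure.totalVariation; infer_instance

instance instIsFiniteMeasureVariation (μ : SignedMeasure α) : IsFiniteMeasure μ.variation := by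
  rw [← SignedMeasure.totalVariation_eq_variation]; infer_instance

lemma integral_signedMeasure_eq_sub (μ : SignedMeasure α) {f : α → ℝ}
    (hf : Integrable f μ.totalVariation) :
    ∫ᵛ x, f x ∂•μ = ∫ x, f x ∂μ.toJordanDecomposition.posPart -
      ∫ x, f x ∂μ.toJordanDecomposition.negPart := by
  have hB : (ContinuousLinearMap.lsmul ℝ ℝ : ℝ →L[ℝ] ℝ →L[ℝ] ℝ) =
      (ContinuousLinearMap.lsmul ℝ ℝ : ℝ →L[ℝ] ℝ →L[ℝ] ℝ).flip := by
    ext; simp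
  have hp : Integrable f μ.toJordanDecomposition.posPart := hf.left_of_add_measure
  have hn : Integrable f μ.toJordanDecomposition.negPart := hf.right_of_add_measure
  rw [hB]
  conv_lhs => rw [← μ.toSignedMeasure_toJordanDecomposition]
  unfold JordanDecomposition.toSignedMeasure
  rw [VectorMeasure.integral_sub_vectorMeasure, VectorMeasure.integral_toSignedMeasure,
    VectorMeasure.integral_toSignedMeasure]
  · rwa [VectorMeasure.Integrable, Measure.variation_toSignedMeasure]
  · rwa [VectorMeasure.Integrable, Measure.variation_toSignedMeasure]

variable [TopologicalSpace α] [CompactSpace α] [BorelSpace α]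

lemma integrable_continuousMap (ν : Measure α) [IsFiniteMeasure ν] (f : C(α, ℝ)) :
    Integrable f ν :=
  Integrable.of_bound f.continuous.aestronglyMeasurable ‖f‖
    (Eventually.of_forall f.norm_coe_le_norm)

/-- The functional `f ↦ ∫ f dμ` on the space of continuous functions. -/
def integralFunctional (μ : SignedMeasure α) : C(α, ℝ) →L[ℝ] ℝ :=
  LinearMap.mkContinuous
    { toFun := fun f => ∫ᵛ x, f x ∂•μ
      map_add' := fun f g => VectorMeasure.integral_fun_add (integrable_continuousMap _ f)
        (integrable_continuousMap _ g)
      map_smul' := fun c f => VectorMeasure.integral_fun_smul _ _ c f }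
    (μ.variation.real univ)
    (fun f => by
      refine (VectorMeasure.norm_integral_le_of_norm_le_const
        (Eventually.of_forall f.norm_coe_le_norm)).trans ?_
      rw [ContinuousLinearMap.opNorm_lsmul, mul_one, mul_comm])

lemma abs_sub_clip_le {s y : ℝ} (hs : |s| ≤ 1) : |s - max (-1) (min y 1)| ≤ |s - y| := by
  have := abs_le.1 hs
  have h := abs_le.1 (le_refl |s - y|)
  rw [abs_le]
  rcases max_cases (-1) (min y 1) with h1 | h1 <;> rcases min_cases y 1 with h2 | h2 <;>
    constructor <;> linarith

/-- The total variation of a signed measure is at most the norm of the associated functional. -/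
lemma totalVariation_le_opNorm [TopologicalSpace.PseudoMetrizableSpace α] (μ : SignedMeasure α) :
    μ.totalVariation.real univ ≤ ‖integralFunctional μ‖ := by
  set p := μ.toJordanDecomposition.posPart with hp
  set n := μ.toJordanDecomposition.negPart with hn
  have hTV : μ.totalVariation = p + n := rfl
  obtain ⟨A, hA, hpA, hnA⟩ := μ.toJordanDecomposition.mutuallySingular
  rw [← hp] at hpA
  rw [← hn] at hnA
  -- The sign of `μ` from its Hahn decomposition: integrating `s` against `μ` gives the total
  -- variation. It remains to approximate `s` by continuous functions in `L¹(p + n)`.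
  set s : α → ℝ := Aᶜ.indicator 1 - A.indicator 1 with hs
  have hs_mem : ∀ x ∈ A, s x = -1 := fun x hx => by simp [hs, hx]
  have hs_notMem : ∀ x ∉ A, s x = 1 := fun x hx => by simp [hs, hx]
  have hs_abs : ∀ x, |s x| ≤ 1 := fun x => by
    by_cases hx : x ∈ A
    · simp [hs_mem x hx]
    · simp [hs_notMem x hx]
  have hsi : Integrable s (p + n) :=
    ((integrable_const 1).indicator hA.compl).sub ((integrable_const 1).indicator hA)
  have hsp : ∀ᵐ x ∂p, s x = 1 :=
    (measure_eq_zero_iff_ae_notMem.1 hpA).mono hs_notMem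
  have hsn : ∀ᵐ x ∂n, s x = -1 :=
    (measure_eq_zero_iff_ae_notMem.1 hnA).mono fun x hx => hs_mem x (not_not.1 hx)
  refine le_of_forall_pos_le_add fun η hη => ?_
  obtain ⟨g, hg, hgi⟩ := hsi.exists_boundedContinuous_integral_sub_le hη
  -- Clipping gives norm at most 1 without increasing the distance to `s`, whose values lie in `[-1,
  -- 1]`.
  set f : C(α, ℝ) := ⟨fun x => max (-1) (min (g x) 1), by fun_prop⟩ with hf
  have hfs : ∀ x, |s x - f x| ≤ ‖s x - g x‖ := fun x => abs_sub_clip_le (hs_abs x)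
  have hfnorm : ‖f‖ ≤ 1 := by
    refine (ContinuousMap.norm_le _ zero_le_one).2 fun x => abs_le.2 ⟨le_max_left _ _, ?_⟩
    exact max_le (by norm_num) (min_le_right _ _)
  have hsg : Integrable (fun x => s x - g x) (p + n) := hsi.sub hgi
  rw [integral_add_measure hsg.norm.left_of_add_measure hsg.norm.right_of_add_measure] at hg
  have h1 : p.real univ - ∫ x, f x ∂p ≤ ∫ x, ‖s x - g x‖ ∂p := by
    have : p.real univ - ∫ x, f x ∂p = ∫ x, (1 - f x) ∂p := by
      rw [integral_sub (integrable_const _) (integrable_continuousMap p f)]; simp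
    rw [this]
    refine integral_mono_ae ((integrable_const _).sub (integrable_continuousMap p f))
      hsg.norm.left_of_add_measure (hsp.mono fun x hx => ?_)
    have := hfs x
    rw [hx] at this
    simpa [hx] using (le_abs_self _).trans this
  have h2 : n.real univ + ∫ x, f x ∂n ≤ ∫ x, ‖s x - g x‖ ∂n := by
    have : n.real univ + ∫ x, f x ∂n = ∫ x, (1 + f x) ∂n := by
      rw [integral_add (integrable_const _) (integrable_continuousMap n f)]; simp
    rw [this]
    refine integral_mono_ae ((integrable_const _).add (integrable_continuousMap n f))
      hsg.norm.right_of_add_measure (hsn.mono fun x hx => ?_)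
    have h3 := (neg_le_abs _).trans (hfs x)
    simp only [hx] at h3 ⊢
    linarith
  have h3 : integralFunctional μ f = ∫ x, f x ∂p - ∫ x, f x ∂n :=
    integral_signedMeasure_eq_sub μ (integrable_continuousMap _ f)
  have h4 : integralFunctional μ f ≤ ‖integralFunctional μ‖ :=
    (le_abs_self _).trans ((integralFunctional μ).le_of_opNorm_le_of_le le_rfl hfnorm |>.trans
      (by simp))
  rw [hTV, measureReal_add_apply]
  linarith

/-- A sequence of signed measures which is pointwise bounded on continuous functions is bounded in
total variation. -/
lemma exists_totalVariation_le [TopologicalSpace.PseudoMetrizableSpace α] {μ : ℕ → SignedMeasure α}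
    (h : ∀ f : C(α, ℝ), ∃ l, Tendsto (fun n => ∫ᵛ x, f x ∂•(μ n)) atTop (𝓝 l)) :
    ∃ M, ∀ n, (μ n).totalVariation.real univ ≤ M := by
  obtain ⟨M, hM⟩ := banach_steinhaus (g := fun n => integralFunctional (μ n)) fun f => by
    obtain ⟨l, hl⟩ := h f
    obtain ⟨C, hC⟩ := hl.norm.bddAbove_range
    exact ⟨C, fun n => hC ⟨n, rfl⟩⟩
  exact ⟨M, fun n => (totalVariation_le_opNorm _).trans (hM n)⟩

/-- If the distribution function of a signed measure is bounded by `C`, then so are the integrals of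
continuous antitone functions with values in `[0, 1]`. -/
lemma abs_integral_le_of_antitone [LinearOrder α] [OrderTopology α]
    (μ : SignedMeasure α) {C : ℝ} (hC : 0 ≤ C) (hμ : ∀ t, |μ (Iic t)| ≤ C)
    (f : C(α, ℝ)) (hf : Antitone f) (hf0 : ∀ x, 0 ≤ f x) (hf1 : ∀ x, f x ≤ 1) :
    |∫ᵛ x, f x ∂•μ| ≤ C := by
  have hmeas : ∀ (ν : Measure α) [IsFiniteMeasure ν],
      IntegrableOn (fun u : ℝ => ν.real {x | u ≤ f x}) (Ioc 0 1) := fun ν _ => by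
    have hanti : AntitoneOn (fun u : ℝ => ν.real {x | u ≤ f x}) (Icc 0 1) :=
      fun u _ w _ huw => measureReal_mono fun x hx => huw.trans hx
    exact (hanti.integrableOn_isCompact isCompact_Icc).mono_set Ioc_subset_Icc_self
  -- Layer cake: the integral is the mean over `u ∈ (0, 1]` of `μ {u ≤ f}`, and each such closed
  -- lower set is empty or some `Iic m`.
  rw [integral_signedMeasure_eq_sub μ (integrable_continuousMap _ f),
    (integrable_continuousMap _ f).integral_eq_integral_Ioc_meas_le (Eventually.of_forall hf0)
      (Eventually.of_forall hf1),
    (integrable_continuousMap _ f).integral_eq_integral_Ioc_meas_le (Eventually.of_forall hf0)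
      (Eventually.of_forall hf1), ← integral_sub (hmeas _) (hmeas _)]
  suffices h : ∀ u ∈ Ioc (0 : ℝ) 1, ‖μ.toJordanDecomposition.posPart.real {x | u ≤ f x} -
      μ.toJordanDecomposition.negPart.real {x | u ≤ f x}‖ ≤ C by
    simpa using norm_setIntegral_le_of_norm_le_const (μ := volume) measure_Ioc_lt_top h
  intro u _
  have hcl : IsClosed {x | u ≤ f x} := isClosed_le continuous_const f.continuous
  rw [← μ.apply_eq_posPart_real_sub_negPart_real hcl.measurableSet]
  rcases eq_empty_or_nonempty {x | u ≤ f x} with he | hne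
  · simpa [he] using hC
  · obtain ⟨m, hm⟩ := hcl.isCompact.exists_isGreatest hne
    have : {x | u ≤ f x} = Iic m :=
      Subset.antisymm hm.2 fun x hx => le_trans hm.1 (hf hx)
    rw [this]
    exact hμ m

end SignedMeasure

/-! ### Discretization of distribution functions -/

/-- Counts the thresholds `h, 2h, …, Kh` lying below `p`; the shift by one excludes the level 0. -/
lemma mul_sum_ite_le_eq_mul_floor {h p : ℝ} (hh : 0 < h) {K : ℕ} (hK : p ≤ K * h) :
    ∑ k : Fin K, (if ((k : ℕ) + 1 : ℝ) * h ≤ p then h else 0) = ⌊p / h⌋₊ * h := by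
  rw [Fin.sum_univ_eq_sum_range (fun k : ℕ => if (k + 1 : ℝ) * h ≤ p then h else 0) K,
    ← Finset.sum_filter, Finset.sum_const, nsmul_eq_mul]
  have hfl : ⌊p / h⌋₊ ≤ K := Nat.floor_le_of_le ((div_le_iff₀ hh).2 hK)
  have : (Finset.range K).filter (fun k : ℕ => (k + 1 : ℝ) * h ≤ p) =
      Finset.range ⌊p / h⌋₊ := by
    ext k
    rw [Finset.mem_filter, Finset.mem_range, Finset.mem_range, ← Nat.add_one_le_iff (m := ⌊p / h⌋₊),
      Nat.le_floor_iff' (Nat.succ_ne_zero k), le_div_iff₀ hh]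
    push_cast
    refine and_iff_right_of_imp fun hk => ?_
    have : (k + 1 : ℝ) * h ≤ K * h := hk.trans hK
    exact_mod_cast le_of_mul_le_mul_right this hh
  rw [this, Finset.card_range]

section Discretization

variable {a b : ℝ}

/-- Continuity from above makes the distribution function right-continuous, so the infimum of a
nonempty superlevel set is attained. -/
lemma superlevel_eq_empty_or_Ici (ρ : Measure (Icc a b)) [IsFiniteMeasure ρ] (r : ℝ) :
    {t | r ≤ ρ.real (Iic t)} = ∅ ∨ ∃ q, {t | r ≤ ρ.real (Iic t)} = Ici q := by
  set S := {t | r ≤ ρ.real (Iic t)} with hS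
  rcases S.eq_empty_or_nonempty with h | hne
  · exact Or.inl h
  have hmono : ∀ s ∈ S, Ici s ⊆ S := fun s hs t ht =>
    le_trans (mem_ofPred.1 hs) (measureReal_mono (Iic_subset_Iic.2 ht))
  have : Nonempty (Icc a b) := ⟨hne.some⟩
  have : Fact (a ≤ b) := ⟨hne.some.2.1.trans hne.some.2.2⟩
  obtain ⟨u, hu, hut, huS⟩ := exists_seq_tendsto_sInf hne (OrderBot.bddBelow S)
  have hinter : Iic (sInf S) = ⋂ n, Iic (u n) := by
    refine Subset.antisymm (fun x hx => mem_iInter.2 fun n =>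
      le_trans hx (csInf_le (OrderBot.bddBelow S) (huS n))) fun x hx => ?_
    exact ge_of_tendsto' hut fun n => mem_iInter.1 hx n
  have hmem : sInf S ∈ S := by
    have h1 : Tendsto (fun n => ρ (Iic (u n))) atTop (𝓝 (ρ (Iic (sInf S)))) := by
      rw [hinter]
      exact tendsto_measure_iInter_atTop (fun n => measurableSet_Iic.nullMeasurableSet)
        (fun m n hmn => Iic_subset_Iic.2 (hu hmn)) ⟨0, measure_ne_top _ _⟩
    exact ge_of_tendsto' ((ENNReal.tendsto_toReal (measure_ne_top _ _)).comp h1) huS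
  exact Or.inr ⟨sInf S, Subset.antisymm (fun t ht => csInf_le (OrderBot.bddBelow S) ht)
    (hmono _ hmem)⟩

/-- A distribution function of mass at most `K h` is at distance at most `h` from a sum of at most
`K` jumps of size at most `h`. -/
lemma exists_steps_measure [Nonempty (Icc a b)] (ρ : Measure (Icc a b)) [IsFiniteMeasure ρ] {h : ℝ}
    (hh : 0 < h) {K : ℕ} (hK : ρ.real univ ≤ K * h) :
    ∃ (c : Fin K → ℝ) (q : Fin K → Icc a b), (∀ k, |c k| ≤ h) ∧
      ∀ t, |ρ.real (Iic t) - ∑ k, c k * (jump (q k) : Icc a b → ℝ) t| ≤ h := by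
  -- The distribution function is rounded down to multiples of `h`, with a jump where it reaches `(k
  -- + 1) h`. Levels never reached get coefficient 0 at an arbitrary point, so the number of terms
  -- is always `K`.
  have hex : ∀ k : Fin K, ∃ (c : ℝ) (q : Icc a b), |c| ≤ h ∧
      ∀ t, c * (jump q : Icc a b → ℝ) t =
        if ((k : ℕ) + 1 : ℝ) * h ≤ ρ.real (Iic t) then h else 0 := by
    intro k
    rcases superlevel_eq_empty_or_Ici ρ (((k : ℕ) + 1 : ℝ) * h) with he | ⟨q, hq⟩
    · refine ⟨0, Classical.arbitrary _, by simpa using hh.le, fun t => ?_⟩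
      rw [zero_mul, if_neg (eq_empty_iff_forall_notMem.1 he t : ¬ _ ≤ _)]
    · refine ⟨h, q, (abs_of_pos hh).le, fun t => ?_⟩
      have ht : ((k : ℕ) + 1 : ℝ) * h ≤ ρ.real (Iic t) ↔ q ≤ t := Set.ext_iff.1 hq t
      rw [jump_apply, if_congr ht rfl rfl, mul_ite, mul_one, mul_zero]
  choose c q hc hq using hex
  refine ⟨c, q, hc, fun t => ?_⟩
  have hp : ρ.real (Iic t) ≤ K * h := (measureReal_mono (subset_univ _)).trans hK
  rw [Finset.sum_congr rfl fun k _ => hq k t, mul_sum_ite_le_eq_mul_floor hh hp]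
  have h1 := Nat.floor_le (div_nonneg (measureReal_nonneg (μ := ρ) (s := Iic t)) hh.le)
  have h2 := Nat.lt_floor_add_one (ρ.real (Iic t) / h)
  rw [le_div_iff₀ hh] at h1
  rw [div_lt_iff₀ hh] at h2
  rw [abs_le]
  constructor <;> linarith

/-- The distribution function of a signed measure of total variation at most `K h` is at distance at
most `2 h` from a sum of at most `2 K` jumps of size at most `h`. -/
lemma exists_steps_signedMeasure [Nonempty (Icc a b)] (μ : SignedMeasure (Icc a b)) {h : ℝ}
    (hh : 0 < h) {K : ℕ} (hK : μ.totalVariation.real univ ≤ K * h) :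
    ∃ (c : Fin K ⊕ Fin K → Icc (-h) h) (q : Fin K ⊕ Fin K → Icc a b),
      ∀ t, |μ (Iic t) - ∑ k, (c k : ℝ) * (jump (q k) : Icc a b → ℝ) t| ≤ 2 * h := by
  have hTV : μ.totalVariation.real univ = μ.toJordanDecomposition.posPart.real univ +
      μ.toJordanDecomposition.negPart.real univ := measureReal_add_apply
  obtain ⟨c, q, hc, hq⟩ := exists_steps_measure μ.toJordanDecomposition.posPart hh (K := K)
    (by linarith [measureReal_nonneg (μ := μ.toJordanDecomposition.negPart) (s := univ)])
  obtain ⟨d, r, hd, hr⟩ := exists_steps_measure μ.toJordanDecomposition.negPart hh (K := K)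
    (by linarith [measureReal_nonneg (μ := μ.toJordanDecomposition.posPart) (s := univ)])
  refine ⟨Sum.elim (fun k => ⟨c k, abs_le.1 (hc k)⟩)
    (fun k => ⟨-d k, abs_le.1 ((abs_neg _).trans_le (hd k))⟩), Sum.elim q r, fun t => ?_⟩
  rw [μ.apply_eq_posPart_real_sub_negPart_real measurableSet_Iic, Fintype.sum_sum_type]
  simp only [Sum.elim_inl, Sum.elim_inr, neg_mul, Finset.sum_neg_distrib]
  have h1 := abs_le.1 (hq t)
  have h2 := abs_le.1 (hr t)
  rw [abs_le]
  constructor <;> linarith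

end Discretization

/-! ### The distribution function of `dv` -/

lemma rightLim_eq_of_isCadlag {a b : ℝ} {v : Icc a b → ℝ} (hv : IsCadlag v) (t : Icc a b) :
    v.rightLim t = v t := by
  rcases eq_or_lt_of_le t.2.2 with h | h
  · exact rightLim_eq_of_isTop fun s => Subtype.coe_le_coe.1 (s.2.2.trans h.ge)
  · have hlt : t < ⟨b, t.2.1.trans h.le, le_rfl⟩ := h
    have : (𝓝[>] t).NeBot := nhdsGT_neBot_of_exists_gt ⟨_, hlt⟩
    exact rightLim_eq_of_tendsto (hv.1 t h)

/-- The Stieltjes part contributes `v t - v a`, and the atom at `a` restores `v a`. -/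
lemma stieltjes_Iic {a b : ℝ} (hab : a ≤ b) {v : Icc a b → ℝ} (hv : BoundedVariationOn v univ)
    (hv' : IsCadlag v) (t : Icc a b) : stieltjes hab hv (Iic t) = v t := by
  set o : Icc a b := ⟨a, left_mem_Icc.2 hab⟩ with ho
  have hbot : IsBot o := fun s => s.2.1
  have hI : Iic t = Icc o t := by
    ext s; exact ⟨fun hs => ⟨hbot s, hs⟩, fun hs => hs.2⟩
  rw [stieltjes, add_apply, hI, hv.vectorMeasure_Icc (hbot t),
    VectorMeasure.dirac_apply_of_mem measurableSet_Icc ⟨le_rfl, hbot t⟩,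
    rightLim_eq_of_isCadlag hv', leftLim_eq_of_isBot hbot, sub_add_cancel]

/-! ### Limits of discretized distribution functions -/

/-- A continuous antitone function on `[a, b]`, equal to `1` on `[a, s]` and to `0` on
`[s + 1 / (n + 1), b]`. -/
def ramp {a b : ℝ} (s : Icc a b) (n : ℕ) : C(Icc a b, ℝ) :=
  ⟨fun x => max 0 (min 1 (1 - (n + 1 : ℝ) * ((x : ℝ) - s))), by fun_prop⟩

lemma ramp_apply {a b : ℝ} (s x : Icc a b) (n : ℕ) :
    ramp s n x = max 0 (min 1 (1 - (n + 1 : ℝ) * ((x : ℝ) - s))) := rfl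

lemma ramp_nonneg {a b : ℝ} (s : Icc a b) (n : ℕ) (x : Icc a b) : 0 ≤ ramp s n x :=
  le_max_left _ _

lemma ramp_le_one {a b : ℝ} (s : Icc a b) (n : ℕ) (x : Icc a b) : ramp s n x ≤ 1 :=
  max_le zero_le_one (min_le_left _ _)

lemma antitone_ramp {a b : ℝ} (s : Icc a b) (n : ℕ) : Antitone (ramp s n) := by
  intro x y hxy
  have : (x : ℝ) ≤ y := hxy
  simp only [ramp_apply]
  gcongr

lemma tendsto_ramp {a b : ℝ} (s x : Icc a b) :
    Tendsto (fun n => ramp s n x) atTop (𝓝 ((Iic s).indicator 1 x)) := by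
  by_cases h : x ≤ s
  · have hx : (x : ℝ) ≤ s := h
    refine tendsto_const_nhds.congr fun n => ?_
    have : (n + 1 : ℝ) * ((x : ℝ) - s) ≤ 0 :=
      mul_nonpos_of_nonneg_of_nonpos (by positivity) (by linarith)
    rw [indicator_of_mem (mem_Iic.2 h), ramp_apply, min_eq_left (by linarith),
      max_eq_right zero_le_one, Pi.one_apply]
  · have hx : (0 : ℝ) < x - s := sub_pos.2 (not_le.1 h)
    rw [indicator_of_notMem (by simpa using h)]
    refine tendsto_const_nhds.congr' ?_
    obtain ⟨N, hN⟩ := exists_nat_gt (1 / ((x : ℝ) - s))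
    filter_upwards [eventually_ge_atTop N] with n hn
    have h1 : 1 / ((x : ℝ) - s) ≤ n + 1 := by
      have : (N : ℝ) ≤ n := by exact_mod_cast hn
      linarith
    rw [div_le_iff₀ hx] at h1
    rw [ramp_apply, max_eq_left (min_le_of_right_le (by linarith))]

lemma tendsto_integral_ramp {a b : ℝ} (μ : SignedMeasure (Icc a b)) (s : Icc a b) :
    Tendsto (fun n => ∫ᵛ x, ramp s n x ∂•μ) atTop (𝓝 (μ (Iic s))) := by
  have hlim : ∀ (ρ : Measure (Icc a b)) [IsFiniteMeasure ρ],
      Tendsto (fun n => ∫ x, ramp s n x ∂ρ) atTop (𝓝 (ρ.real (Iic s))) := fun ρ _ => by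
    rw [← integral_indicator_one measurableSet_Iic]
    refine tendsto_integral_of_dominated_convergence (fun _ => 1)
      (fun n => (ramp s n).continuous.aestronglyMeasurable) (integrable_const _)
      (fun n => Eventually.of_forall fun x => ?_) (Eventually.of_forall fun x => tendsto_ramp s x)
    rw [Real.norm_of_nonneg (ramp_nonneg s n x)]
    exact ramp_le_one s n x
  rw [μ.apply_eq_posPart_real_sub_negPart_real measurableSet_Iic]
  simp_rw [fun n => integral_signedMeasure_eq_sub μ (integrable_continuousMap _ (ramp s n))]
  exact (hlim _).sub (hlim _)

/-- The signed measure with atoms `c k` at the points `q k`. -/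
def atomic {a b : ℝ} {κ : Type*} [Fintype κ] (c : κ → ℝ) (q : κ → Icc a b) :
    SignedMeasure (Icc a b) :=
  ∑ k, VectorMeasure.dirac (q k) (c k)

lemma atomic_Iic {a b : ℝ} {κ : Type*} [Fintype κ] (c : κ → ℝ) (q : κ → Icc a b) (t : Icc a b) :
    atomic c q (Iic t) = ∑ k, c k * (jump (q k) : Icc a b → ℝ) t := by
  rw [atomic, sum_apply]
  refine Finset.sum_congr rfl fun k _ => ?_
  rw [jump_apply]
  split_ifs with h
  · rw [VectorMeasure.dirac_apply_of_mem measurableSet_Iic (mem_Iic.2 h), mul_one]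
  · rw [VectorMeasure.dirac_apply_of_notMem (by simpa using h), mul_zero]

lemma integral_atomic {a b : ℝ} {κ : Type*} [Fintype κ] (c : κ → ℝ) (q : κ → Icc a b)
    (f : C(Icc a b, ℝ)) : ∫ᵛ x, f x ∂•(atomic c q) = ∑ k, f (q k) * c k := by
  rw [atomic, VectorMeasure.integral_finsetSum_vectorMeasure
    fun k _ => integrable_continuousMap _ f]
  refine Finset.sum_congr rfl fun k _ => ?_
  rw [VectorMeasure.integral_dirac]
  simp

/-- If the distribution functions of `μₙ` are within `C` of sums of jumps, and `μₙ → μ₀` weakly,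
then the distribution function of `μ₀` is within `C` of the limiting sum of jumps. -/
lemma abs_sub_steps_le_of_tendsto {a b : ℝ} {κ : Type*} [Fintype κ]
    {μ : ℕ → SignedMeasure (Icc a b)} {μ₀ : SignedMeasure (Icc a b)}
    (hμ : ∀ f : C(Icc a b, ℝ),
      Tendsto (fun n => ∫ᵛ t, f t ∂•(μ n)) atTop (𝓝 (∫ᵛ t, f t ∂•μ₀)))
    {c : ℕ → κ → ℝ} {c₀ : κ → ℝ} (hc : Tendsto c atTop (𝓝 c₀))
    {q : ℕ → κ → Icc a b} {q₀ : κ → Icc a b} (hq : Tendsto q atTop (𝓝 q₀)) {C : ℝ} (hC : 0 ≤ C)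
    (h : ∀ n t, |μ n (Iic t) - ∑ k, c n k * (jump (q n k) : Icc a b → ℝ) t| ≤ C) (t : Icc a b) :
    |μ₀ (Iic t) - ∑ k, c₀ k * (jump (q₀ k) : Icc a b → ℝ) t| ≤ C := by
  have hint : ∀ (m : SignedMeasure (Icc a b)) (d : κ → ℝ) (r : κ → Icc a b) (f : C(Icc a b, ℝ)),
      ∫ᵛ x, f x ∂•(m - atomic d r) = ∫ᵛ x, f x ∂•m - ∑ k, f (r k) * d k := fun m d r f => by
    rw [VectorMeasure.integral_sub_vectorMeasure (integrable_continuousMap _ f)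
      (integrable_continuousMap _ f), integral_atomic]
  rw [tendsto_pi_nhds] at hc hq
  -- Weak convergence does not give convergence of distribution functions at every point. The bound
  -- is therefore transferred to continuous antitone test functions, passed to the limit there, and
  -- recovered on `Iic t` as `N → ∞`.
  have hramp : ∀ N, |∫ᵛ x, ramp t N x ∂•(μ₀ - atomic c₀ q₀)| ≤ C := fun N => by
    have hlim : Tendsto (fun n => ∫ᵛ x, ramp t N x ∂•(μ n - atomic (c n) (q n))) atTop
        (𝓝 (∫ᵛ x, ramp t N x ∂•(μ₀ - atomic c₀ q₀))) := by
      simp_rw [hint]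
      exact (hμ _).sub (tendsto_finsetSum _ fun k _ =>
        (((ramp t N).continuous.tendsto _).comp (hq k)).mul (hc k))
    refine le_of_tendsto' hlim.abs fun n => ?_
    refine abs_integral_le_of_antitone _ hC (fun s => ?_) _ (antitone_ramp t N) (ramp_nonneg t N)
      (ramp_le_one t N)
    rw [sub_apply, atomic_Iic]
    exact h n s
  have := le_of_tendsto' (tendsto_integral_ramp (μ₀ - atomic c₀ q₀) t).abs hramp
  rwa [sub_apply, atomic_Iic] at this

/-! ### Comparison with linear topologies -/

/-- The sum of the jumps `c k` at the points `q k`. -/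
def steps {a b : ℝ} {κ : Type*} [Fintype κ] (c : κ → ℝ) (q : κ → Icc a b) : Skorokhod a b :=
  ∑ k, c k • jump (q k)

lemma steps_apply {a b : ℝ} {κ : Type*} [Fintype κ] (c : κ → ℝ) (q : κ → Icc a b) (t : Icc a b) :
    (steps c q : Icc a b → ℝ) t = ∑ k, c k * (jump (q k) : Icc a b → ℝ) t := by
  simp [steps]

lemma exists_nhds_zero_add_mem {E : Type*} [AddCommGroup E] [TopologicalSpace E] [ContinuousAdd E]
    {x : E} {U : Set E} (hU : U ∈ 𝓝 x) :
    ∃ V ∈ 𝓝 (0 : E), ∀ u ∈ V, ∀ v ∈ V, ∀ w ∈ V, x + (u + v + w) ∈ U := by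
  have hcont : Continuous fun p : E × E × E => x + (p.1 + p.2.1 + p.2.2) := by fun_prop
  have h := hcont.continuousAt (x := 0) (by simpa using hU)
  rw [Filter.mem_map, Prod.zero_eq_mk, Prod.zero_eq_mk, nhds_prod_eq, nhds_prod_eq] at h
  obtain ⟨A, hA, B, hB, hAB⟩ := mem_prod_iff.1 h
  obtain ⟨D, hD, F, hF, hDF⟩ := mem_prod_iff.1 hB
  refine ⟨A ∩ (D ∩ F), inter_mem hA (inter_mem hD hF), fun u hu v hv w hw => ?_⟩
  have hvw : (v, w) ∈ B := hDF ⟨hv.2.1, hw.2.2⟩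
  have huvw : (u, v, w) ∈ A ×ˢ B := ⟨hu.1, hvw⟩
  exact hAB huvw

/-- Linearity of `σ` is essential here: in `mJ₁`, two distinct jumps merging into one point need not
converge to their sum. -/
lemma continuous_steps {a b : ℝ} {κ : Type*} [Fintype κ] (σ : TopologicalSpace (Skorokhod a b))
    (hadd : ContinuousAdd (Skorokhod a b)) (hsmul : ContinuousSMul ℝ (Skorokhod a b))
    (hjump : Continuous[_, σ] (jump : Icc a b → Skorokhod a b)) :
    Continuous[_, σ] fun p : (κ → ℝ) × (κ → Icc a b) => steps p.1 p.2 := by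
  unfold steps
  refine continuous_finsetSum _ fun k _ => ?_
  exact ((continuous_apply k).comp continuous_fst).smul
    (hjump.comp ((continuous_apply k).comp continuous_snd))

/-- Under `S`-convergence, the terms of the sequence enter infinitely often every neighbourhood of
the limit, for every linear topology coarser than `mJ₁`. -/
lemma SConv.exists_mem_of_mem_nhds {T : ℝ} (hT : 0 ≤ T) {ε : ℝ} (hε : 0 < ε)
    (σ : TopologicalSpace (Skorokhod 0 T))
    (hadd : ContinuousAdd (Skorokhod 0 T)) (hsmul : ContinuousSMul ℝ (Skorokhod 0 T))
    (hσ : mJ1Topology hT ε ≤ σ) {x : ℕ → Skorokhod 0 T} {x₀ : Skorokhod 0 T}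
    (hx : SConv hT x x₀) {U : Set (Skorokhod 0 T)} (hU : U ∈ @nhds _ σ x₀) : ∃ n, x n ∈ U := by
  have : Nonempty (Icc 0 T) := ⟨⟨0, left_mem_Icc.2 hT⟩⟩
  obtain ⟨V, hV, hVU⟩ := exists_nhds_zero_add_mem hU
  obtain ⟨η, hη, hball⟩ := exists_uniform_ball_subset hT ε (nhds_mono hσ hV)
  -- One `h` pays for `x - v` and two for `v - w`.
  set h := η / 3 with hh
  have hh0 : 0 < h := by positivity
  obtain ⟨v, v₀, hv, hv₀, hxv, hxv₀, hlim⟩ := hx h hh0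
  obtain ⟨M, hM⟩ := exists_totalVariation_le fun f => ⟨_, hlim f⟩
  obtain ⟨K, hK⟩ := exists_nat_ge (M / h)
  rw [div_le_iff₀ hh0] at hK
  choose c q hcq using fun n => exists_steps_signedMeasure (stieltjes hT (hv n)) hh0
    ((hM n).trans hK)
  -- The uniform `K` and the coefficient type `Icc (-h) h` put all parameters in one compact space.
  obtain ⟨⟨c₀, q₀⟩, φ, hφ, hφlim⟩ := CompactSpace.tendsto_subseq fun n => (c n, q n)
  have hclim : Tendsto (fun n k => (c (φ n) k : ℝ)) atTop (𝓝 fun k => (c₀ k : ℝ)) := by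
    have : Continuous fun (p : Fin K ⊕ Fin K → Icc (-h) h) k => (p k : ℝ) := by fun_prop
    exact (this.tendsto _).comp hφlim.fst_nhds
  have hqlim : Tendsto (fun n => q (φ n)) atTop (𝓝 q₀) := hφlim.snd_nhds
  set w : ℕ → Skorokhod 0 T := fun n => steps (fun k => (c n k : ℝ)) (q n) with hw
  set w₀ : Skorokhod 0 T := steps (fun k => (c₀ k : ℝ)) q₀ with hw₀
  have hvw : ∀ n t, |(v n : Icc 0 T → ℝ) t - (w n : Icc 0 T → ℝ) t| ≤ 2 * h := fun n t => by
    have := hcq n t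
    rwa [stieltjes_Iic hT (hv n) (v n).2, ← steps_apply] at this
  have hvw₀ : ∀ t, |(v₀ : Icc 0 T → ℝ) t - (w₀ : Icc 0 T → ℝ) t| ≤ 2 * h := fun t => by
    have := abs_sub_steps_le_of_tendsto (fun f => (hlim f).comp hφ.tendsto_atTop) hclim hqlim
      (by positivity) (fun n t => hcq (φ n) t) t
    rwa [stieltjes_Iic hT hv₀ v₀.2, ← steps_apply] at this
  have hwlim : Tendsto (fun n => w (φ n) - w₀) atTop (@nhds _ σ 0) := by
    have h1 : Tendsto (fun n => w (φ n)) atTop (@nhds _ σ w₀) :=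
      ((continuous_steps σ hadd hsmul (continuous_le_rng hσ (continuous_jump hT hε))).tendsto
        (_, _)).comp (hclim.prodMk_nhds hqlim)
    have h2 := h1.add (tendsto_const_nhds (x := -w₀))
    simpa [sub_eq_add_neg] using h2
  obtain ⟨n, hn⟩ := (hwlim.eventually_mem hV).exists
  refine ⟨φ n, ?_⟩
  have hdec : x (φ n) = x₀ + ((x (φ n) - w (φ n)) + (w (φ n) - w₀) + (w₀ - x₀)) := by abel
  rw [hdec]
  refine hVU _ (hball _ fun t => ?_) _ hn _ (hball _ fun t => ?_)
  · have h1 := abs_le.1 (hxv (φ n) t)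
    have h2 := abs_le.1 (hvw (φ n) t)
    change |(x (φ n) : Icc 0 T → ℝ) t - (w (φ n) : Icc 0 T → ℝ) t| ≤ η
    rw [abs_le]
    constructor <;> linarith
  · have h1 := abs_le.1 (hxv₀ t)
    have h2 := abs_le.1 (hvw₀ t)
    change |(w₀ : Icc 0 T → ℝ) t - (x₀ : Icc 0 T → ℝ) t| ≤ η
    rw [abs_le]
    constructor <;> linarith

end SkorokhodS

end

/-- Every linear (vector space) topology `σ` on `𝔻([0, T])` that is coarser than `mJ₁` is coarser
than the `S` topology. In Mathlib's order on topologies, `t ≤ σ` says that every `σ`-open set is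
`t`-open, that is, that `σ` is coarser than `t`. -/
theorem theorem4p3 (T : ℝ) (hT : 0 < T) (ε : ℝ) (hε : 0 < ε)
    (σ : TopologicalSpace (SkorokhodS.Skorokhod 0 T))
    (hadd : @ContinuousAdd (SkorokhodS.Skorokhod 0 T) σ _)
    (hsmul : @ContinuousSMul ℝ (SkorokhodS.Skorokhod 0 T) _ _ σ)
    (hσ : SkorokhodS.mJ1Topology hT.le ε ≤ σ) :
    SkorokhodS.STopology hT.le ≤ σ := by
  -- `S`-openness of `U` unfolds to sequential closedness of its complement: here `xₙ ∉ U` for all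
  -- `n`, while `x₀ ∈ U` is to be refuted.
  intro U hU x x₀ hx hconv hx₀
  have hU' : U ∈ @nhds _ σ x₀ := IsOpen.mem_nhds hU hx₀
  obtain ⟨n, hn⟩ := hconv.exists_mem_of_mem_nhds hT.le hε σ hadd hsmul hσ hU'
  exact hx n hn
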